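/- Let $d\ge 1$ and let $\Omega\subset\mathbb R^d$ be a bounded convex open set (in particular, any uniformly convex domain is allowed). Then there is a constant $C>0$, depending only on $\Omega$ (and $d$), with the following property. Let $f_1,f_2\in C(\overline\Omega)$ with $f_1,f_2\ge 0$, let $g_1,g_2\in C(\partial\Omega)$, and for $i=1,2$ let $u_i\in C(\overline\Omega)$ be a convex viscosity solution of the Monge–Ampère Dirichlet problem $$\det D^2u_i=f_i\ \text{ in }\Omega,\qquad u_i=g_i\ \text{ on }\partial\Omega .$$ Then $$\|u_1-u_2\|_{L^\infty(\Omega)}\le C\,\|f_1-f_2\|_{L^\infty(\Omega)}^{1/d}+\|g_1-g_2\|_{L^\infty(\partial\Omega)} .$$ Here $u\in C(\overline\Omega)$ is a convex viscosity solution with data $(f,g)$ if $u$ is convex in $\Omega$, $u=g$ pointwise on $\partial\Omega$, and for every convex $\varphi\in C^2(\Omega)$ and every $x_0\in\Omega$: $\det D^2\varphi(x_0)\ge f(x_0)$ whenever $u-\varphi$ has a local maximum at $x_0$, and $\det D^2\varphi(x_0)\le f(x_0)$ whenever $u-\varphi$ has a local minimum at $x_0$. All functions being continuous, the $L^\infty$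 norms are suprema of absolute values over $\Omega$ and over $\partial\Omega$. -/

import Mathlib

namespace MongeAmpere

noncomputable section

/-- The Hessian matrix `D²φ(x) = (∂²φ / ∂xᵢ ∂xⱼ)(x)` in the standard basis of `ℝᵈ`. -/
def hessian {d : ℕ} (φ : EuclideanSpace ℝ (Fin d) → ℝ) (x : EuclideanSpace ℝ (Fin d)) :
    Matrix (Fin d) (Fin d) ℝ :=
  Matrix.of fun i j =>
    fderiv ℝ (fderiv ℝ φ) x (EuclideanSpace.single i 1) (EuclideanSpace.single j 1)

/-- `u` satisfies `det D²u ≥ f` in the open set `Ω` in the viscosity sense: the inequality holds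
for every convex test function `φ ∈ C²(Ω)` at every point of `Ω` at which `u - φ` has a local
maximum. -/
def IsViscositySubsolution {d : ℕ} (Ω : Set (EuclideanSpace ℝ (Fin d)))
    (f u : EuclideanSpace ℝ (Fin d) → ℝ) : Prop :=
  ∀ φ : EuclideanSpace ℝ (Fin d) → ℝ, ContDiffOn ℝ 2 φ Ω → ConvexOn ℝ Ω φ →
    ∀ x ∈ Ω, IsLocalMax (fun y => u y - φ y) x → f x ≤ (hessian φ x).det

/-- `u` satisfies `det D²u ≤ f` in the open set `Ω` in the viscosity sense: the inequality holds
for every convex test function `φ ∈ C²(Ω)` at every point of `Ω` at which `u - φ` has a local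
minimum. -/
def IsViscositySupersolution {d : ℕ} (Ω : Set (EuclideanSpace ℝ (Fin d)))
    (f u : EuclideanSpace ℝ (Fin d) → ℝ) : Prop :=
  ∀ φ : EuclideanSpace ℝ (Fin d) → ℝ, ContDiffOn ℝ 2 φ Ω → ConvexOn ℝ Ω φ →
    ∀ x ∈ Ω, IsLocalMin (fun y => u y - φ y) x → (hessian φ x).det ≤ f x

/-- `u ∈ C(closure Ω)` is a convex viscosity solution of the Dirichlet problem
`det D²u = f` in `Ω`, `u = g` on `∂Ω`, the boundary condition holding pointwise. -/
structure IsConvexViscositySolution {d : ℕ} (Ω : Set (EuclideanSpace ℝ (Fin d)))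
    (f g u : EuclideanSpace ℝ (Fin d) → ℝ) : Prop where
  continuousOn : ContinuousOn u (closure Ω)
  convexOn : ConvexOn ℝ Ω u
  subsolution : IsViscositySubsolution Ω f u
  supersolution : IsViscositySupersolution Ω f u
  boundary : ∀ x ∈ frontier Ω, u x = g x

/-- The supremum norm `sup_{x ∈ S} |w x|`. It is used only for functions that are bounded on `S`:
restrictions to `S` of functions that are continuous on a compact set containing `S`. For such
functions it is the `L^∞` norm when `S` is open, or is the boundary of a bounded convex open set
with its surface measure. -/
def supNorm {d : ℕ} (S : Set (EuclideanSpace ℝ (Fin d)))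
    (w : EuclideanSpace ℝ (Fin d) → ℝ) : ℝ :=
  ⨆ x : S, |w x|

end

end MongeAmpere

/-! By symmetry it suffices to bound `u₁ - u₂` from above. Let `R` bound the norm on the closure of
`Ω`, let `a ^ d > ε`, and suppose `u₁ - u₂` exceeds `m + a / 2 * R ^ 2` somewhere. Then `w = u₁ + a
/ 2 * ‖·‖ ^ 2` minus `u₂` has its large values only in the interior. Formally, contact there gives
`D²u₂ ≥ D²u₁ + a I`, hence `f₂ ≥ f₁ + a ^ d > f₁ + ε`, which is absurd; letting `a` decrease to `ε ^
(1 / d)` gives the estimate.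

To make this rigorous for viscosity solutions only `u₂` is regularised. By convexity its Moreau
envelope `v` is `C^{1,1}`, and the proximal map `P` carries a quadratic minorant of `v` at `x` to
one of `u₂` at `P x`. The contact points of `w - v` under small linear tilts map onto a ball of
slopes by a Lipschitz map, so they are not a null set (`exists_contact_notMem_null`); Rademacher's
theorem then yields one at which `v` has a second-order expansion, with Hessian `B`. There `B - a I`
tests `u₁` at `x`, `B` tests `u₂` at `P x`, and `det B ≥ det (B - a I) + a ^ d`
(`add_pow_le_of_contact`). -/

namespace MongeAmpere

open Filter Topology Metric

/-! ### Quadratic test functions and determinants -/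

section TestFunctions

variable {d : ℕ}

local notation "E" => EuclideanSpace ℝ (Fin d)

/-- The quadratic polynomial with gradient `ℓ` at `x` and second derivative `B`. -/
noncomputable def quad (ℓ : E →L[ℝ] ℝ) (B : E →L[ℝ] E →L[ℝ] ℝ) (x y : E) : ℝ :=
  ℓ (y - x) + B (y - x) (y - x) / 2

/-- The form `B + a ⟪·, ·⟫`. -/
noncomputable def addInner (B : E →L[ℝ] E →L[ℝ] ℝ) (a : ℝ) : E →L[ℝ] E →L[ℝ] ℝ :=
  B + a • show E →L[ℝ] E →L[ℝ] ℝ from innerSL ℝ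

theorem addInner_apply (B : E →L[ℝ] E →L[ℝ] ℝ) (a : ℝ) (v w : E) :
    addInner B a v w = B v w + a * inner ℝ v w := rfl

/-- The Gram matrix of a bilinear form in the standard basis. -/
noncomputable def gram (B : E →L[ℝ] E →L[ℝ] ℝ) : Matrix (Fin d) (Fin d) ℝ :=
  Matrix.of fun i j => B (EuclideanSpace.single i 1) (EuclideanSpace.single j 1)

theorem hasFDerivAt_quad (ℓ : E →L[ℝ] ℝ) {B : E →L[ℝ] E →L[ℝ] ℝ} (hB : ∀ v w, B v w = B w v)
    (x y : E) : HasFDerivAt (quad ℓ B x) (ℓ + B (y - x)) y := by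
  have h1 : HasFDerivAt (fun y : E => y - x) (ContinuousLinearMap.id ℝ E) y :=
    (hasFDerivAt_id y).sub_const x
  have h2 := (ℓ.hasFDerivAt.comp y h1).add
    ((B.hasFDerivAt_of_bilinear h1 h1).const_smul (1 / 2 : ℝ))
  refine (h2.congr_fderiv ?_).congr_of_eventuallyEq (Eventually.of_forall fun z => ?_)
  · ext v
    have := hB v (y - x)
    simp at this ⊢
    linarith
  · simp [quad]
    ring

theorem hessian_quad (ℓ : E →L[ℝ] ℝ) {B : E →L[ℝ] E →L[ℝ] ℝ} (hB : ∀ v w, B v w = B w v)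
    (x y : E) : hessian (quad ℓ B x) y = gram B := by
  have h : fderiv ℝ (quad ℓ B x) = fun y => ℓ + B (y - x) :=
    funext fun y => (hasFDerivAt_quad ℓ hB x y).fderiv
  have h' : HasFDerivAt (fun y => ℓ + B (y - x)) B y := by
    have h1 : HasFDerivAt (fun y : E => y - x) (ContinuousLinearMap.id ℝ E) y :=
      (hasFDerivAt_id y).sub_const x
    exact (B.hasFDerivAt.comp y h1).const_add ℓ
  ext i j
  rw [hessian, gram, Matrix.of_apply, Matrix.of_apply, h, h'.fderiv]

theorem contDiff_quad (ℓ : E →L[ℝ] ℝ) (B : E →L[ℝ] E →L[ℝ] ℝ) (x : E) :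
    ContDiff ℝ 2 (quad ℓ B x) := by
  unfold quad
  fun_prop

theorem convexOn_quad (ℓ : E →L[ℝ] ℝ) {B : E →L[ℝ] E →L[ℝ] ℝ} (hB : ∀ v w, B v w = B w v)
    (hB0 : ∀ v, 0 ≤ B v v) (x : E) {s : Set E} (hs : Convex ℝ s) :
    ConvexOn ℝ s (quad ℓ B x) := by
  refine ⟨hs, fun y _ z _ a b ha hb hab => ?_⟩
  have h := mul_nonneg (mul_nonneg ha hb) (hB0 ((y - x) - (z - x)))
  have e : a • y + b • z - x = a • (y - x) + b • (z - x) := by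
    obtain rfl : b = 1 - a := by linarith
    module
  unfold quad
  rw [e]
  generalize y - x = v at *
  generalize z - x = w at *
  simp only [map_sub, map_add, map_smul, sub_apply, add_apply, smul_apply,
    smul_eq_mul, hB w v] at h ⊢
  obtain rfl : b = 1 - a := by linarith
  nlinarith

theorem gram_isHermitian {B : E →L[ℝ] E →L[ℝ] ℝ} (hB : ∀ v w, B v w = B w v) :
    (gram B).IsHermitian := by
  ext i j
  simp [gram, hB (EuclideanSpace.single j 1)]

theorem gram_posSemidef {B : E →L[ℝ] E →L[ℝ] ℝ} (hB : ∀ v w, B v w = B w v)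
    (hB0 : ∀ v, 0 ≤ B v v) : (gram B).PosSemidef := by
  refine Matrix.PosSemidef.of_dotProduct_mulVec_nonneg (gram_isHermitian hB) fun v => ?_
  have h := hB0 (∑ i, v i • EuclideanSpace.single i 1)
  simp only [map_sum, map_smul, sum_apply, smul_apply, smul_eq_mul] at h
  simp only [gram, dotProduct, Matrix.mulVec, Matrix.of_apply, Pi.star_apply, star_trivial]
  refine h.trans_eq (Finset.sum_congr rfl fun i _ => congrArg _ (Finset.sum_congr rfl fun j _ => ?_))
  rw [hB, mul_comm]

theorem gram_addInner (B : E →L[ℝ] E →L[ℝ] ℝ) (a : ℝ) :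
    gram (addInner B a) = gram B + Matrix.scalar (Fin d) a := by
  ext i j
  simp [gram, addInner_apply, Matrix.diagonal_apply, EuclideanSpace.inner_single_left]

/-- In terms of the eigenvalues this is `∏ λᵢ + ∏ a ≤ ∏ (λᵢ + a)`, two of the nonnegative terms in
the expanded product. They are different terms because `d ≥ 1`. -/
theorem _root_.Matrix.PosSemidef.det_add_pow_le_det_add_scalar (hd : 1 ≤ d)
    {M : Matrix (Fin d) (Fin d) ℝ} (hM : M.PosSemidef) {a : ℝ} (ha : 0 ≤ a) :
    M.det + a ^ d ≤ (M + Matrix.scalar (Fin d) a).det := by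
  have h1 : (M + Matrix.scalar (Fin d) a).det = ∏ i, (hM.1.eigenvalues i + a) := by
    have h := congrArg (Polynomial.eval (-a)) hM.1.charpoly_eq
    rw [Matrix.eval_charpoly, Polynomial.eval_prod] at h
    have e : Matrix.scalar (Fin d) (-a) - M = -(M + Matrix.scalar (Fin d) a) := by
      rw [map_neg]
      abel
    rw [e, Matrix.det_neg] at h
    have h2 : ∏ i, Polynomial.eval (-a)
        (Polynomial.X - Polynomial.C ((hM.1.eigenvalues i : ℝ))) =
        (-1) ^ Fintype.card (Fin d) * ∏ i, (hM.1.eigenvalues i + a) := by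
      rw [← Finset.card_univ, ← Finset.prod_const, ← Finset.prod_mul_distrib]
      refine Finset.prod_congr rfl fun i _ => ?_
      simp
      ring
    exact mul_left_cancel₀ (pow_ne_zero _ (by norm_num)) (h.trans h2)
  have h2 : M.det = ∏ i, hM.1.eigenvalues i := by
    simpa using hM.1.det_eq_prod_eigenvalues
  have h3 : a ^ d = ∏ _i : Fin d, a := by simp
  rw [h1, h2, h3]
  exact Finset.prod_add_prod_le (Finset.mem_univ (⟨0, hd⟩ : Fin d)) le_rfl
    (fun j _ _ => by linarith) (fun j _ _ => by linarith [hM.eigenvalues_nonneg j])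
    (fun j _ => hM.eigenvalues_nonneg j) (fun _ _ => ha)

theorem tendsto_det_gram (B : E →L[ℝ] E →L[ℝ] ℝ) :
    Tendsto (fun δ : ℝ => (gram (addInner B δ)).det) (𝓝 0) (𝓝 (gram B).det) := by
  have h : Continuous fun δ : ℝ => (gram (addInner B δ)).det := by
    simp_rw [gram_addInner]
    refine Continuous.matrix_det ?_
    simp only [Matrix.scalar_apply]
    fun_prop
  have e : gram (addInner B 0) = gram B := by rw [gram_addInner, map_zero, add_zero]
  simpa only [e] using h.tendsto 0

theorem addInner_symm {B : E →L[ℝ] E →L[ℝ] ℝ} (hB : ∀ v w, B v w = B w v) (a : ℝ)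
    (v w : E) : (addInner B a) v w = (addInner B a) w v := by
  simp [addInner_apply, hB v w, real_inner_comm]

theorem addInner_self (B : E →L[ℝ] E →L[ℝ] ℝ) (a : ℝ) (v : E) :
    (addInner B a) v v = B v v + a * ‖v‖ ^ 2 := by
  simp [addInner_apply]

/-- A symmetric form dominating a convex function to second order is nonnegative. -/
theorem nonneg_of_isLocalMax_sub_quad {Ω : Set E} (hΩ : IsOpen Ω) {u : E → ℝ}
    (hu : ConvexOn ℝ Ω u) {ℓ : E →L[ℝ] ℝ} {B : E →L[ℝ] E →L[ℝ] ℝ} {x : E} (hx : x ∈ Ω)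
    (h : IsLocalMax (fun y => u y - quad ℓ B x y) x) (v : E) : 0 ≤ B v v := by
  have hx' : ∀ᶠ y in 𝓝 x, y ∈ Ω := hΩ.mem_nhds hx
  have t1 : Tendsto (fun t : ℝ => x + t • v) (𝓝 0) (𝓝 x) := by
    have : Continuous fun t : ℝ => x + t • v := by fun_prop
    simpa using this.tendsto 0
  have t2 : Tendsto (fun t : ℝ => x - t • v) (𝓝 0) (𝓝 x) := by
    have : Continuous fun t : ℝ => x - t • v := by fun_prop
    simpa using this.tendsto 0
  have key : ∀ᶠ t in 𝓝[>] (0 : ℝ), 0 ≤ t ^ 2 * B v v := by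
    refine nhdsWithin_le_nhds ?_
    filter_upwards [t1.eventually h, t2.eventually h, t1.eventually hx', t2.eventually hx']
      with t h1 h2 m1 m2
    -- Convexity at the midpoint of `x ± t • v`: the linear parts of the quadratic cancel.
    have hc := hu.2 m1 m2 (by norm_num : (0 : ℝ) ≤ 1 / 2) (by norm_num : (0 : ℝ) ≤ 1 / 2)
      (by norm_num)
    have e : (1 / 2 : ℝ) • (x + t • v) + (1 / 2 : ℝ) • (x - t • v) = x := by
      module
    rw [e] at hc
    simp [quad] at h1 h2 hc
    linarith
  obtain ⟨t, ht, ht0⟩ := (key.and self_mem_nhdsWithin).exists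
  exact nonneg_of_mul_nonneg_right ht (pow_pos ht0 2)

/-- The quadratic dominates `u` only up to `o(‖y - x‖ ^ 2)`, so `B + δ` is tested and `δ → 0`.
Convexity of the test function is inherited from `u`. -/
theorem IsViscositySubsolution.le_det_gram {Ω : Set E} (hΩ : IsOpen Ω) {f u : E → ℝ}
    (hu : ConvexOn ℝ Ω u) (hs : IsViscositySubsolution Ω f u) {ℓ : E →L[ℝ] ℝ}
    {B : E →L[ℝ] E →L[ℝ] ℝ} (hB : ∀ v w, B v w = B w v) {x : E} (hx : x ∈ Ω)
    (h : ∀ δ > 0, ∀ᶠ y in 𝓝 x, u y ≤ u x + quad ℓ B x y + δ * ‖y - x‖ ^ 2) :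
    (∀ v, 0 ≤ B v v) ∧ f x ≤ (gram B).det := by
  have hmax : ∀ δ : ℝ, 0 < δ → IsLocalMax (fun y => u y - quad ℓ (addInner B δ) x y) x := by
    intro δ hδ
    filter_upwards [h (δ / 2) (half_pos hδ)] with y hy
    simp only [quad, addInner_self, sub_self, map_zero] at hy ⊢
    linarith
  have hpos : ∀ δ : ℝ, 0 < δ → ∀ v, 0 ≤ (addInner B δ) v v := fun δ hδ v =>
    nonneg_of_isLocalMax_sub_quad hΩ hu hx (hmax δ hδ) v
  constructor
  · intro v
    have t : Tendsto (fun δ : ℝ => B v v + δ * ‖v‖ ^ 2) (𝓝[>] 0) (𝓝 (B v v)) := by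
      have : Continuous fun δ : ℝ => B v v + δ * ‖v‖ ^ 2 := by fun_prop
      refine Tendsto.mono_left ?_ nhdsWithin_le_nhds
      simpa using this.tendsto 0
    refine ge_of_tendsto t ?_
    filter_upwards [self_mem_nhdsWithin] with δ hδ
    rw [← addInner_self]
    exact hpos δ hδ v
  · refine ge_of_tendsto ((tendsto_det_gram B).mono_left (nhdsWithin_le_nhds (s := Set.Ioi 0))) ?_
    filter_upwards [self_mem_nhdsWithin] with δ hδ
    have hsymm := addInner_symm hB δ
    rw [← hessian_quad ℓ hsymm x x]
    exact hs _ (contDiff_quad _ _ _).contDiffOn (convexOn_quad ℓ hsymm (hpos δ hδ) x hu.1) x hx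
      (hmax δ hδ)

/-- Touching from below does not force convexity of the test function; the lower bound `a` on `B`
keeps `B - δ` admissible for `δ < a`. -/
theorem IsViscositySupersolution.det_gram_le {Ω : Set E} (hΩ : Convex ℝ Ω) {f u : E → ℝ}
    (hs : IsViscositySupersolution Ω f u) {ℓ : E →L[ℝ] ℝ}
    {B : E →L[ℝ] E →L[ℝ] ℝ} (hB : ∀ v w, B v w = B w v) {a : ℝ} (ha : 0 < a)
    (hBa : ∀ v, a * ‖v‖ ^ 2 ≤ B v v) {x : E} (hx : x ∈ Ω)
    (h : ∀ δ > 0, ∀ᶠ y in 𝓝 x, u x + quad ℓ B x y - δ * ‖y - x‖ ^ 2 ≤ u y) :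
    (gram B).det ≤ f x := by
  have t : Tendsto (fun δ : ℝ => (gram (addInner B (-δ))).det) (𝓝[>] 0)
      (𝓝 (gram B).det) := by
    refine ((tendsto_det_gram B).comp ?_).mono_left nhdsWithin_le_nhds
    simpa using (continuous_neg (G := ℝ)).tendsto 0
  refine le_of_tendsto t ?_
  filter_upwards [Ioo_mem_nhdsGT ha] with δ hδ
  have hsymm := addInner_symm hB (-δ)
  rw [← hessian_quad ℓ hsymm x x]
  refine hs _ (contDiff_quad _ _ _).contDiffOn (convexOn_quad ℓ hsymm (fun v => ?_) x hΩ) x hx ?_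
  · rw [addInner_self]
    nlinarith [hBa v, hδ.2, sq_nonneg ‖v‖]
  · filter_upwards [h (δ / 2) (half_pos hδ.1)] with y hy
    simp only [quad, addInner_self, sub_self, map_zero] at hy ⊢
    linarith

end TestFunctions

/-! ### First-order limits and convexity up to the boundary -/

theorem nonpos_of_forall_mul_le_sq_mul {A C : ℝ}
    (h : ∀ᶠ t in 𝓝[>] (0 : ℝ), t * A ≤ t ^ 2 * C) : A ≤ 0 := by
  have t1 : Tendsto (fun t : ℝ => t * C) (𝓝[>] 0) (𝓝 0) := by
    refine Tendsto.mono_left ?_ nhdsWithin_le_nhds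
    simpa using (continuous_mul_const C).tendsto 0
  refine ge_of_tendsto t1 ?_
  filter_upwards [h, self_mem_nhdsWithin] with t ht ht0
  have ht0 : 0 < t := ht0
  have : t * A ≤ t * (t * C) := by linarith
  exact le_of_mul_le_mul_left this ht0

theorem _root_.ConvexOn.closure_of_continuousOn {F : Type*} [NormedAddCommGroup F]
    [NormedSpace ℝ F] {s : Set F} {u : F → ℝ} (hu : ConvexOn ℝ s u)
    (hc : ContinuousOn u (closure s)) : ConvexOn ℝ (closure s) u := by
  refine ⟨hu.1.closure, fun x hx y hy a b ha hb hab => ?_⟩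
  have hmem : ∀ p ∈ closure s ×ˢ closure s, a • p.1 + b • p.2 ∈ closure s := fun p hp =>
    hu.1.closure hp.1 hp.2 ha hb hab
  have hxy : (x, y) ∈ closure (s ×ˢ s) := by
    rw [closure_prod_eq]
    exact ⟨hx, hy⟩
  have hsub : s ×ˢ s ⊆ closure s ×ˢ closure s := Set.prod_mono subset_closure subset_closure
  have h1 : ContinuousOn (fun p : F × F => u (a • p.1 + b • p.2)) (closure s ×ˢ closure s) :=
    hc.comp (by fun_prop) hmem
  have h2 : ContinuousOn (fun p : F × F => a • u p.1 + b • u p.2) (closure s ×ˢ closure s) :=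
    ((hc.comp continuousOn_fst fun p hp => hp.1).const_smul a).add
      ((hc.comp continuousOn_snd fun p hp => hp.2).const_smul b)
  exact ContinuousWithinAt.closure_le hxy ((h1 (x, y) ⟨hx, hy⟩).mono hsub)
    ((h2 (x, y) ⟨hx, hy⟩).mono hsub) fun p hp => hu.2 hp.1 hp.2 ha hb hab

/-! ### The Moreau envelope of a convex function -/

section Envelope

variable {F : Type*} [NormedAddCommGroup F] [InnerProductSpace ℝ F]

/-- `v` is the Moreau envelope of `u` on `K` with parameter `κ`, and `P x` is a point of `K` at
which the minimum defining `v x` is attained. -/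
structure IsMoreauEnvelope (K : Set F) (u : F → ℝ) (κ : ℝ) (v : F → ℝ) (P : F → F) : Prop where
  mem : ∀ x, P x ∈ K
  eq : ∀ x, v x = u (P x) + κ / 2 * ‖x - P x‖ ^ 2
  le : ∀ x, ∀ y ∈ K, v x ≤ u y + κ / 2 * ‖x - y‖ ^ 2

omit [InnerProductSpace ℝ F] in
theorem exists_isMoreauEnvelope {K : Set F} (hK : IsCompact K) (hne : K.Nonempty) {u : F → ℝ}
    (hu : ContinuousOn u K) (κ : ℝ) : ∃ v P, IsMoreauEnvelope K u κ v P := by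
  have h : ∀ x, ∃ p ∈ K, IsMinOn (fun y => u y + κ / 2 * ‖x - y‖ ^ 2) K p := fun x =>
    hK.exists_isMinOn hne (hu.add (by fun_prop))
  choose P hP hmin using h
  exact ⟨fun x => u (P x) + κ / 2 * ‖x - P x‖ ^ 2, P, hP, fun _ => rfl, fun x y hy => hmin x hy⟩

namespace IsMoreauEnvelope

variable {K : Set F} {u v : F → ℝ} {κ : ℝ} {P : F → F}

theorem le_add_quadratic (h : IsMoreauEnvelope K u κ v P) (x y : F) :
    v y ≤ v x + inner ℝ (κ • (x - P x)) (y - x) + κ / 2 * ‖y - x‖ ^ 2 := by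
  have h1 := h.le y _ (h.mem x)
  have e : y - P x = (x - P x) + (y - x) := by abel
  rw [h.eq x, real_inner_smul_left]
  rw [e, norm_add_sq_real] at h1
  linarith

/-- First-order optimality of `P x` along the segment towards `z`. -/
theorem subgradient (h : IsMoreauEnvelope K u κ v P) (hu : ConvexOn ℝ K u) (x : F) {z : F}
    (hz : z ∈ K) : u (P x) + κ * inner ℝ (x - P x) (z - P x) ≤ u z := by
  suffices H : u (P x) + κ * inner ℝ (x - P x) (z - P x) - u z ≤ 0 by linarith
  refine nonpos_of_forall_mul_le_sq_mul (C := κ / 2 * ‖z - P x‖ ^ 2) ?_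
  filter_upwards [Ioo_mem_nhdsGT (zero_lt_one (α := ℝ))] with t ht
  have h0 : 0 ≤ 1 - t := by linarith [ht.2]
  have h1 := h.le x _ (hu.1 (h.mem x) hz h0 ht.1.le (by ring))
  have h2 := hu.2 (h.mem x) hz h0 ht.1.le (by ring)
  have e : x - ((1 - t) • P x + t • z) = (x - P x) - t • (z - P x) := by module
  rw [h.eq x, e, norm_sub_sq_real (x - P x) (t • (z - P x)), real_inner_smul_right, norm_smul, mul_pow,
    Real.norm_eq_abs, sq_abs] at h1
  simp only [smul_eq_mul] at h2
  linarith

/-- Monotonicity of subgradients, then Cauchy–Schwarz. -/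
theorem lipschitzWith (h : IsMoreauEnvelope K u κ v P) (hκ : 0 < κ) (hu : ConvexOn ℝ K u) :
    LipschitzWith 1 P := by
  refine LipschitzWith.of_dist_le_mul fun x y => ?_
  rw [dist_eq_norm, dist_eq_norm, NNReal.coe_one, one_mul]
  have h1 := h.subgradient hu x (h.mem y)
  have h2 := h.subgradient hu y (h.mem x)
  have e : inner ℝ (x - P x) (P y - P x) + inner ℝ (y - P y) (P x - P y) =
      ‖P x - P y‖ ^ 2 - inner ℝ (x - y) (P x - P y) := by
    rw [← real_inner_self_eq_norm_sq]
    simp only [inner_sub_left, inner_sub_right]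
    ring
  have h3 : κ * (‖P x - P y‖ ^ 2 - inner ℝ (x - y) (P x - P y)) ≤ 0 := by
    rw [← e]
    linarith
  have h4 : ‖P x - P y‖ ^ 2 ≤ inner ℝ (x - y) (P x - P y) := by
    by_contra hc
    linarith [mul_pos hκ (sub_pos.2 (not_le.1 hc))]
  have h5 := real_inner_le_norm (x - y) (P x - P y)
  by_contra hc
  nlinarith [norm_nonneg (x - y), norm_nonneg (P x - P y)]

theorem norm_grad_sub_le (h : IsMoreauEnvelope K u κ v P) (hκ : 0 < κ) (hu : ConvexOn ℝ K u)
    (x y : F) : ‖κ • (x - P x) - κ • (y - P y)‖ ≤ 2 * κ * ‖x - y‖ := by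
  have h1 := (h.lipschitzWith hκ hu).dist_le_mul x y
  rw [dist_eq_norm, dist_eq_norm, NNReal.coe_one, one_mul] at h1
  have e : κ • (x - P x) - κ • (y - P y) = κ • ((x - y) - (P x - P y)) := by module
  rw [e, norm_smul, Real.norm_of_nonneg hκ.le]
  have h2 := norm_sub_le (x - y) (P x - P y)
  nlinarith

/-- The quadratic upper bound based at `y` gives a lower bound at `x`, once the candidate gradient
is known to be Lipschitz. -/
theorem hasFDerivAt (h : IsMoreauEnvelope K u κ v P) (hκ : 0 < κ) (hu : ConvexOn ℝ K u) (x : F) :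
    HasFDerivAt v (innerSL ℝ (κ • (x - P x))) x := by
  have hO : (fun y => v y - v x - innerSL ℝ (κ • (x - P x)) (y - x)) =O[𝓝 x]
      fun y => ‖y - x‖ ^ 2 := by
    refine Asymptotics.IsBigO.of_bound (3 * κ) (Eventually.of_forall fun y => ?_)
    rw [Real.norm_of_nonneg (sq_nonneg ‖y - x‖), Real.norm_eq_abs, innerSL_apply_apply, abs_le]
    have h1 := h.le_add_quadratic x y
    have h2 := h.le_add_quadratic y x
    have h3 := real_inner_le_norm (κ • (x - P x) - κ • (y - P y)) (y - x)
    have h4 := h.norm_grad_sub_le hκ hu x y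
    rw [norm_sub_rev x y] at h2 h4
    have e : inner ℝ (κ • (y - P y)) (x - y) = - inner ℝ (κ • (y - P y)) (y - x) := by
      rw [← inner_neg_right, neg_sub]
    rw [e] at h2
    rw [inner_sub_left] at h3
    have h5 := mul_le_mul_of_nonneg_right h4 (norm_nonneg (y - x))
    have h6 := mul_nonneg hκ.le (sq_nonneg ‖y - x‖)
    constructor <;> nlinarith
  refine HasFDerivAt.of_isLittleO (hO.trans_isLittleO ?_)
  exact (Asymptotics.isLittleO_norm_pow_id one_lt_two).comp_tendsto
    (tendsto_sub_nhds_zero_iff.2 tendsto_id)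

omit [InnerProductSpace ℝ F] in
/-- A quadratic minorant of the envelope at `x` is a quadratic minorant of `u` at `P x`. -/
theorem add_sub_le (h : IsMoreauEnvelope K u κ v P) (x : F) {y : F} (hy : y ∈ K) :
    u (P x) + (v (x + (y - P x)) - v x) ≤ u y := by
  have h1 := h.le (x + (y - P x)) y hy
  have e : x + (y - P x) - y = x - P x := by abel
  rw [e] at h1
  linarith [h.eq x]

end IsMoreauEnvelope

end Envelope

/-- Second-order Taylor expansion at a point where the derivative is differentiable. -/
theorem isLittleO_second_order {F : Type*} [NormedAddCommGroup F] [NormedSpace ℝ F] {v : F → ℝ}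
    {v' : F → F →L[ℝ] ℝ} (hv : ∀ y, HasFDerivAt v (v' y) y) {B : F →L[ℝ] F →L[ℝ] ℝ} {x : F}
    (hB : HasFDerivAt v' B x) {δ : ℝ} (hδ : 0 < δ) :
    ∀ᶠ y in 𝓝 x, |v y - v x - v' x (y - x) - B (y - x) (y - x) / 2| ≤ δ * ‖y - x‖ ^ 2 := by
  have hsymm : ∀ a b, B a b = B b a := second_derivative_symmetric hv hB
  have hlit := hB.isLittleO.def hδ
  obtain ⟨ε, hε, hball⟩ := Metric.eventually_nhds_iff_ball.1 hlit
  filter_upwards [ball_mem_nhds x hε] with y hy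
  have hder : ∀ z, HasFDerivAt (fun z => v z - v x - v' x (z - x) - B (z - x) (z - x) / 2)
      (v' z - v' x - B (z - x)) z := by
    intro z
    have h1 : HasFDerivAt (fun y : F => y - x) (ContinuousLinearMap.id ℝ F) z :=
      (hasFDerivAt_id z).sub_const x
    have h2 := (((hv z).sub_const (v x)).sub ((v' x).hasFDerivAt.comp z h1)).sub
      ((B.hasFDerivAt_of_bilinear h1 h1).const_smul (1 / 2 : ℝ))
    refine (h2.congr_fderiv ?_).congr_of_eventuallyEq (Eventually.of_forall fun w => ?_)
    · ext a
      have := hsymm a (z - x)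
      simp at this ⊢
      linarith
    · simp
      ring
  have hbound : ∀ z ∈ closedBall x ‖y - x‖, ‖v' z - v' x - B (z - x)‖ ≤ δ * ‖y - x‖ := by
    intro z hz
    rw [mem_closedBall, dist_eq_norm] at hz
    rw [mem_ball, dist_eq_norm] at hy
    refine (hball z (by rw [mem_ball, dist_eq_norm]; linarith)).trans ?_
    gcongr
  -- The mean value inequality on this ball supplies the second factor `‖y - x‖`.
  have := (convex_closedBall x ‖y - x‖).norm_image_sub_le_of_norm_hasFDerivWithin_le
    (fun z _ => (hder z).hasFDerivWithinAt) hbound (mem_closedBall_self (norm_nonneg _))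
    (show y ∈ closedBall x ‖y - x‖ by rw [mem_closedBall, dist_eq_norm])
  simp only [sub_self, map_zero, zero_div, sub_zero, Real.norm_eq_abs] at this
  linarith

open MeasureTheory

/-! ### Contact points of tilted functions -/

section Contact

variable {F : Type*} [NormedAddCommGroup F] [InnerProductSpace ℝ F]

/-- At a point where a convex function is touched from above by a function with a quadratic upper
bound, the gradient of the latter is a subgradient. -/
theorem add_inner_le_of_isMaxOn {Ω : Set F} {w v : F → ℝ} (hw : ConvexOn ℝ Ω w) {G : F → F}
    {κ : ℝ} (hv : ∀ x y, v y ≤ v x + inner ℝ (G x) (y - x) + κ / 2 * ‖y - x‖ ^ 2) {x p : F}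
    (hx : Ω ∈ 𝓝 x) (hmax : IsMaxOn (fun y => w y - v y - inner ℝ p y) Ω x) {y : F} (hy : y ∈ Ω) :
    w x + inner ℝ (G x + p) (y - x) ≤ w y := by
  suffices H : w x + inner ℝ (G x + p) (y - x) - w y ≤ 0 by linarith
  refine nonpos_of_forall_mul_le_sq_mul (C := κ / 2 * ‖y - x‖ ^ 2) ?_
  have t1 : Tendsto (fun t : ℝ => x - t • (y - x)) (𝓝[>] 0) (𝓝 x) := by
    have : Continuous fun t : ℝ => x - t • (y - x) := by fun_prop
    refine Tendsto.mono_left ?_ nhdsWithin_le_nhds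
    simpa using this.tendsto 0
  filter_upwards [t1.eventually hx, self_mem_nhdsWithin] with t ht ht0
  have ht0 : 0 < t := ht0
  -- Contact bounds `w` above at the reflected point `x - t • (y - x)`; convexity through `x` turns
  -- this into a lower bound at `y`.
  have h1 := hmax ht
  have h2 := hv x (x - t • (y - x))
  have h3 := hw.2 hy ht (by positivity : (0 : ℝ) ≤ t / (1 + t))
    (by positivity : (0 : ℝ) ≤ 1 / (1 + t)) (by field_simp; ring)
  have e : (t / (1 + t)) • y + (1 / (1 + t)) • (x - t • (y - x)) = x := by
    have h0 : (1 + t) ≠ 0 := by positivity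
    have : (1 + t) • ((t / (1 + t)) • y + (1 / (1 + t)) • (x - t • (y - x))) = (1 + t) • x := by
      rw [smul_add, smul_smul, smul_smul, mul_div_cancel₀ _ h0, mul_div_cancel₀ _ h0]
      module
    exact smul_right_injective F h0 this
  have e' : x - t • (y - x) - x = -(t • (y - x)) := by abel
  rw [e] at h3
  simp only [Set.mem_ofPred_eq] at h1
  rw [e', inner_neg_right, real_inner_smul_right, norm_neg, norm_smul, mul_pow,
    Real.norm_eq_abs, sq_abs] at h2
  rw [inner_sub_right, real_inner_smul_right] at h1
  have h4 : (1 + t) * w x ≤ t * w y + w (x - t • (y - x)) := by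
    have := mul_le_mul_of_nonneg_left h3 (by positivity : 0 ≤ 1 + t)
    simp only [smul_eq_mul] at this
    have e3 : (1 + t) * (t / (1 + t) * w y + 1 / (1 + t) * w (x - t • (y - x))) =
        t * w y + w (x - t • (y - x)) := by field_simp
    linarith
  rw [inner_add_left]
  linarith

/-- `G x + p` and `G x' + p'` are subgradients of `w`, and `w` also has quadratic upper bounds at
`x` and `x'`. Comparing these at a point displaced from `x'` by `s` along `Q` bounds `s * ‖Q‖`; the
choice `s = ‖x - x'‖` is optimal. For `x = x'` the slope is unique. -/
theorem norm_gradient_sub_le_of_isMaxOn {Ω : Set F} {w v : F → ℝ} (hw : ConvexOn ℝ Ω w)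
    {G : F → F} {κ : ℝ} (hκ : 0 ≤ κ)
    (hv : ∀ x y, v y ≤ v x + inner ℝ (G x) (y - x) + κ / 2 * ‖y - x‖ ^ 2)
    {ρ : ℝ} (hρ : 0 < ρ) {x x' p p' : F} (hx : ball x ρ ⊆ Ω) (hx' : ball x' ρ ⊆ Ω)
    (hmax : IsMaxOn (fun y => w y - v y - inner ℝ p y) Ω x)
    (hmax' : IsMaxOn (fun y => w y - v y - inner ℝ p' y) Ω x') (hxx : ‖x - x'‖ < ρ) :
    ‖G x + p - (G x' + p')‖ ≤ κ * ‖x - x'‖ := by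
  set Q := G x + p - (G x' + p') with hQ
  have key : ∀ s, 0 < s → s < ρ → s * ‖Q‖ ≤ κ / 2 * (‖x - x'‖ ^ 2 + s ^ 2) := by
    intro s hs hsρ
    obtain hQ0 | hQ0 := eq_or_ne Q 0
    · rw [hQ0, norm_zero, mul_zero]
      positivity
    set z := x' + (s / ‖Q‖) • Q with hz
    have hQn : 0 < ‖Q‖ := norm_pos_iff.2 hQ0
    have hzx : ‖z - x'‖ = s := by
      rw [hz, add_sub_cancel_left, norm_smul, Real.norm_of_nonneg (by positivity)]
      field_simp
    have hzΩ : z ∈ Ω := hx' (by rw [mem_ball, dist_eq_norm, hzx]; exact hsρ)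
    have hx'Ω : x' ∈ Ω := hx' (mem_ball_self hρ)
    have h1 := add_inner_le_of_isMaxOn hw hv (mem_of_superset (ball_mem_nhds x hρ) hx) hmax hzΩ
    have h2 := hmax' hzΩ
    have h3 := hmax hx'Ω
    have h4 := hv x' z
    have h5 := hv x x'
    have h6 : inner ℝ Q (z - x') = s * ‖Q‖ := by
      rw [hz, add_sub_cancel_left, real_inner_smul_right, real_inner_self_eq_norm_sq]
      field_simp
    simp only [Set.mem_ofPred_eq] at h2 h3
    rw [hzx] at h4
    rw [norm_sub_rev x' x] at h5
    rw [← h6, hQ]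
    simp only [inner_add_left, inner_sub_left, inner_sub_right] at *
    linarith
  obtain h0 | h0 := (norm_nonneg (x - x')).eq_or_lt
  · rw [← h0, mul_zero]
    refine nonpos_of_forall_mul_le_sq_mul (C := κ / 2) ?_
    filter_upwards [Ioo_mem_nhdsGT hρ] with s hs
    have := key s hs.1 hs.2
    rw [← h0] at this
    linarith
  · have := key _ h0 hxx
    refine le_of_mul_le_mul_left ?_ h0
    linarith

/-- If a convex function `w` minus a `C^{1,1}` function `v` attains, for every small slope `p`, the
maximum of its tilt by `p` at an interior point, then the contact points are not contained in a null
set. -/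
theorem exists_contact_notMem_null [FiniteDimensional ℝ F] [MeasurableSpace F] [BorelSpace F]
    (μ : Measure F) [μ.IsAddHaarMeasure] {Ω S : Set F} {w v : F → ℝ} (hw : ConvexOn ℝ Ω w)
    {G : F → F} {κ : ℝ} (hκ : 0 < κ)
    (hv : ∀ x y, v y ≤ v x + inner ℝ (G x) (y - x) + κ / 2 * ‖y - x‖ ^ 2)
    (hG : ∀ x y, ‖G x - G y‖ ≤ 2 * κ * ‖x - y‖)
    {ρ : ℝ} (hρ : 0 < ρ) (hS : ∀ x ∈ S, ball x ρ ⊆ Ω) {r : ℝ} (hr : 0 < r)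
    (hmax : ∀ p ∈ ball (0 : F) r, ∃ x ∈ S, IsMaxOn (fun y => w y - v y - inner ℝ p y) Ω x)
    {N : Set F} (hN : μ N = 0) :
    ∃ x ∈ S, x ∉ N ∧ ∃ p, IsMaxOn (fun y => w y - v y - inner ℝ p y) Ω x := by
  by_contra! hcon
  set T := {x ∈ S | ∃ p ∈ ball (0 : F) r, IsMaxOn (fun y => w y - v y - inner ℝ p y) Ω x}
    with hT
  have hTN : T ⊆ N := by
    rintro x ⟨hx, p, -, hp⟩
    by_contra hxN
    exact hcon x hx hxN p hp
  have hsel : ∀ x, ∃ p, x ∈ T → p ∈ ball (0 : F) r ∧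
      IsMaxOn (fun y => w y - v y - inner ℝ p y) Ω x := by
    intro x
    by_cases hx : x ∈ T
    · obtain ⟨-, p, hp, hm⟩ := hx
      exact ⟨p, fun _ => ⟨hp, hm⟩⟩
    · exact ⟨0, fun h => absurd h hx⟩
  choose π hπ using hsel
  have hclose : ∀ x ∈ S, ∀ x' ∈ S, ∀ p p',
      IsMaxOn (fun y => w y - v y - inner ℝ p y) Ω x →
      IsMaxOn (fun y => w y - v y - inner ℝ p' y) Ω x' → ‖x - x'‖ < ρ →
      ‖p - p'‖ ≤ 3 * κ * ‖x - x'‖ := by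
    intro x hx x' hx' p p' hp hp' hxx
    have h1 := norm_gradient_sub_le_of_isMaxOn hw hκ.le hv hρ (hS x hx) (hS x' hx') hp hp' hxx
    have e : p - p' = (G x + p - (G x' + p')) - (G x - G x') := by abel
    rw [e]
    linarith [norm_sub_le (G x + p - (G x' + p')) (G x - G x'), hG x x']
  -- The term `3 * κ` serves pairs closer than `ρ`; for the others, slopes in a ball of radius `r`
  -- differ by at most `2 * r`.
  have hlip : LipschitzOnWith (Real.toNNReal (3 * κ + 2 * r / ρ)) π T := by
    refine LipschitzOnWith.of_dist_le_mul fun x hx x' hx' => ?_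
    rw [dist_eq_norm, dist_eq_norm, Real.coe_toNNReal _ (by positivity)]
    obtain h | h := lt_or_ge ‖x - x'‖ ρ
    · have h1 := hclose x hx.1 x' hx'.1 _ _ (hπ x hx).2 (hπ x' hx').2 h
      have : 0 ≤ 2 * r / ρ * ‖x - x'‖ := by positivity
      linarith
    · have h1 := mem_ball_zero_iff.1 (hπ x hx).1
      have h2 := mem_ball_zero_iff.1 (hπ x' hx').1
      have h3 := norm_sub_le (π x) (π x')
      have h4 : 2 * r ≤ 2 * r / ρ * ‖x - x'‖ := by
        rw [div_mul_eq_mul_div, le_div_iff₀ hρ]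
        gcongr
      have : 0 ≤ 3 * κ * ‖x - x'‖ := by positivity
      linarith
  have himage : ball (0 : F) r ⊆ π '' T := by
    intro p hp
    obtain ⟨x, hxS, hx⟩ := hmax p hp
    have hxT : x ∈ T := ⟨hxS, p, hp, hx⟩
    refine ⟨x, hxT, ?_⟩
    have := hclose x hxS x hxS _ _ (hπ x hxT).2 hx (by simpa using hρ)
    rw [sub_self, norm_zero, mul_zero] at this
    exact sub_eq_zero.1 (norm_le_zero_iff.1 this)
  -- A Lipschitz image of a null set is null, but this image contains a ball.
  have hN' : Measure.hausdorffMeasure (Module.finrank ℝ F : ℝ) T = 0 :=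
    measure_mono_null hTN (Measure.absolutelyContinuous_isAddHaarMeasure _ μ hN)
  have h0 := hlip.hausdorffMeasure_image_le (d := Module.finrank ℝ F) (by positivity)
  rw [hN', mul_zero] at h0
  have h1 := (measure_mono himage).trans h0
  exact (isOpen_ball.measure_pos _ (nonempty_ball.2 hr)).not_ge h1

end Contact

/-! ### Comparison and the stability estimate -/

section Comparison

variable {d : ℕ}

local notation "E" => EuclideanSpace ℝ (Fin d)

theorem add_pow_le_of_contact (hd : 1 ≤ d) {Ω : Set E} (hΩ : IsOpen Ω) {f₁ f₂ u₁ u₂ : E → ℝ}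
    (hu₁ : ConvexOn ℝ Ω u₁) (hs₁ : IsViscositySubsolution Ω f₁ u₁)
    (hs₂ : IsViscositySupersolution Ω f₂ u₂) (hu₂ : ConvexOn ℝ (closure Ω) u₂) {κ : ℝ}
    (hκ : 0 < κ) {v : E → ℝ} {P : E → E} (hv : IsMoreauEnvelope (closure Ω) u₂ κ v P) {a : ℝ}
    (ha : 0 < a) {x p : E} (hx : x ∈ Ω) (hPx : P x ∈ Ω)
    (hmax : IsMaxOn (fun y => u₁ y + a / 2 * ‖y‖ ^ 2 - v y - inner ℝ p y) Ω x)
    (hdiff : DifferentiableAt ℝ (fun y => innerSL ℝ (κ • (y - P y))) x) :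
    f₁ x + a ^ d ≤ f₂ (P x) := by
  set v' : E → E →L[ℝ] ℝ := fun y => innerSL ℝ (κ • (y - P y)) with hv'
  have hder : ∀ y, HasFDerivAt v (v' y) y := hv.hasFDerivAt hκ hu₂
  obtain ⟨B, hB⟩ := hdiff
  have hsymm : ∀ s t, B s t = B t s := second_derivative_symmetric hder hB
  have hsub := hs₁.le_det_gram hΩ hu₁ (ℓ := v' x + innerSL ℝ (p - a • x))
    (addInner_symm hsymm (-a)) hx fun δ hδ => by
      filter_upwards [isLittleO_second_order hder hB hδ, hΩ.mem_nhds hx] with y hy hyΩ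
      have h1 := hmax hyΩ
      have h2 := (abs_le.1 hy).2
      have h3 : ‖y‖ ^ 2 = ‖x‖ ^ 2 + 2 * inner ℝ x (y - x) + ‖y - x‖ ^ 2 := by
        rw [← norm_add_sq_real, add_sub_cancel]
      simp only [Set.mem_ofPred_eq] at h1
      rw [quad, addInner_self, add_apply, innerSL_apply_apply ℝ (p - a • x), inner_sub_left,
        real_inner_smul_left, inner_sub_right p]
      rw [h3] at h1
      linarith
  have hBa : ∀ t, a * ‖t‖ ^ 2 ≤ B t t := fun t => by
    have := hsub.1 t
    rw [addInner_self] at this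
    linarith
  have hsup := hs₂.det_gram_le hu₁.1 (ℓ := v' x) hsymm ha hBa hPx fun δ hδ => by
    have t1 : Tendsto (fun y => x + (y - P x)) (𝓝 (P x)) (𝓝 x) := by
      have : Continuous fun y => x + (y - P x) := by fun_prop
      simpa using this.tendsto (P x)
    filter_upwards [t1.eventually (isLittleO_second_order hder hB hδ), hΩ.mem_nhds hPx]
      with y hy hyΩ
    have h1 := hv.add_sub_le x (subset_closure hyΩ)
    have h2 := (abs_le.1 hy).1
    rw [add_sub_cancel_left] at h2
    rw [quad]
    linarith
  have hdet := (gram_posSemidef (addInner_symm hsymm (-a)) hsub.1).det_add_pow_le_det_add_scalar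
    hd ha.le
  have e : gram (addInner B (-a)) + Matrix.scalar (Fin d) a = gram B := by
    rw [gram_addInner, map_neg, neg_add_cancel_right]
  rw [e] at hdet
  linarith [hsub.2]

theorem convexOn_add_sq_norm {Ω : Set E} {u : E → ℝ} (hu : ConvexOn ℝ Ω u) {a : ℝ}
    (ha : 0 ≤ a) : ConvexOn ℝ Ω fun y => u y + a / 2 * ‖y‖ ^ 2 := by
  have h := convexOn_quad 0 (addInner_symm (B := (0 : E →L[ℝ] E →L[ℝ] ℝ)) (fun _ _ => rfl) a)
    (fun v => by
      rw [addInner_self]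
      simp only [zero_apply]
      positivity) 0 hu.1
  refine hu.add (h.congr fun y _ => ?_)
  simp only [quad, addInner_self, zero_apply, sub_zero]
  ring

theorem sub_le_of_lt_pow (hd : 1 ≤ d) {Ω : Set E} (hΩ : IsOpen Ω) {R : ℝ}
    (hR : ∀ y ∈ closure Ω, ‖y‖ ≤ R) {f₁ f₂ g₁ g₂ u₁ u₂ : E → ℝ}
    (hf₂ : ContinuousOn f₂ (closure Ω)) (h₁ : IsConvexViscositySolution Ω f₁ g₁ u₁)
    (h₂ : IsConvexViscositySolution Ω f₂ g₂ u₂) {ε a m : ℝ} (ha : 0 < a) (hε : ε < a ^ d)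
    (hf : ∀ x ∈ Ω, f₂ x ≤ f₁ x + ε) (hm : ∀ x ∈ frontier Ω, g₁ x - g₂ x ≤ m) {x₀ : E}
    (hx₀ : x₀ ∈ closure Ω) : u₁ x₀ - u₂ x₀ ≤ m + a / 2 * R ^ 2 := by
  by_contra! hlt
  have hK : IsCompact (closure Ω) :=
    Metric.isCompact_of_isClosed_isBounded isClosed_closure
      (isBounded_iff_forall_norm_le.2 ⟨R, hR⟩)
  have hR0 : 0 ≤ R := (norm_nonneg _).trans (hR x₀ hx₀)
  set w : E → ℝ := fun y => u₁ y + a / 2 * ‖y‖ ^ 2 with hw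
  have hwc : ContinuousOn w (closure Ω) := h₁.continuousOn.add (by fun_prop)
  set h : E → ℝ := fun y => w y - u₂ y with hh
  have hhc : ContinuousOn h (closure Ω) := hwc.sub h₂.continuousOn
  set M : ℝ := m + a / 2 * R ^ 2 with hM
  have hfr : ∀ y ∈ closure Ω, M < h y → y ∈ Ω := by
    intro y hy hMy
    by_contra hyΩ
    have hyf : y ∈ frontier Ω := ⟨hy, by rwa [hΩ.interior_eq]⟩
    have k1 := hm y hyf
    have k2 := pow_le_pow_left₀ (norm_nonneg y) (hR y hy) 2
    have k3 : a / 2 * ‖y‖ ^ 2 ≤ a / 2 * R ^ 2 := by gcongr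
    simp only [hh, hw, h₁.boundary y hyf, h₂.boundary y hyf] at hMy
    linarith
  -- Of the surplus `5 * τ`, replacing `u₂` by `v` and tilting cost `τ` each, so contact points have
  -- `h ≥ M + 3 * τ`. Passing to `P x` costs another `τ` and still leaves `h > M`, hence `P x ∈ Ω`.
  set τ : ℝ := (h x₀ - M) / 5 with hτ
  have hτ0 : 0 < τ := by
    have : 0 ≤ a / 2 * ‖x₀‖ ^ 2 := by positivity
    simp only [hτ, hh, hw]
    linarith
  have hhx₀ : h x₀ = M + 5 * τ := by
    rw [hτ]
    ring
  obtain ⟨δ₁, hδ₁, hu₂δ⟩ := Metric.uniformContinuousOn_iff.1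
    (hK.uniformContinuousOn_of_continuous h₂.continuousOn) τ hτ0
  obtain ⟨δ₂, hδ₂, hhδ⟩ := Metric.uniformContinuousOn_iff.1
    (hK.uniformContinuousOn_of_continuous hhc) τ hτ0
  obtain ⟨δ₃, hδ₃, hfδ⟩ := Metric.uniformContinuousOn_iff.1
    (hK.uniformContinuousOn_of_continuous hf₂) (a ^ d - ε) (sub_pos.2 hε)
  set δ : ℝ := min δ₁ (min δ₂ δ₃) with hδdef
  have hδ : 0 < δ := lt_min hδ₁ (lt_min hδ₂ hδ₃)
  obtain ⟨b, hb⟩ := hK.exists_bound_of_continuousOn h₂.continuousOn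
  have hb0 : 0 ≤ b := (norm_nonneg _).trans (hb x₀ hx₀)
  -- Since `|u₂| ≤ b`, minimality gives `κ * ‖x - P x‖ ^ 2 ≤ 4 * b < κ * δ ^ 2`.
  set κ : ℝ := (4 * b + 1) / δ ^ 2 with hκdef
  have hκ : 0 < κ := by positivity
  have hu₂c : ConvexOn ℝ (closure Ω) u₂ := h₂.convexOn.closure_of_continuousOn h₂.continuousOn
  obtain ⟨v, P, hv⟩ := exists_isMoreauEnvelope hK ⟨x₀, hx₀⟩ h₂.continuousOn κ
  have hder := hv.hasFDerivAt hκ hu₂c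
  have hvc : Continuous v := continuous_iff_continuousAt.2 fun x => (hder x).continuousAt
  have hvle : ∀ x ∈ closure Ω, v x ≤ u₂ x := fun x hx => by simpa using hv.le x x hx
  have hP : ∀ x ∈ closure Ω, dist x (P x) < δ := by
    intro x hx
    rw [dist_eq_norm]
    have k1 := hvle x hx
    rw [hv.eq x] at k1
    have k2 := abs_le.1 (hb x hx)
    have k3 := abs_le.1 (hb _ (hv.mem x))
    have k4 : κ * δ ^ 2 = 4 * b + 1 := by
      rw [hκdef]
      field_simp
    refine lt_of_pow_lt_pow_left₀ 2 hδ.le ?_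
    refine lt_of_mul_lt_mul_left ?_ hκ.le
    linarith [k2.2, k3.1]
  have hvge : ∀ x ∈ closure Ω, u₂ x - τ ≤ v x := by
    intro x hx
    have k1 := hu₂δ x hx _ (hv.mem x) ((hP x hx).trans_le (min_le_left _ _))
    rw [Real.dist_eq] at k1
    have k2 := (abs_lt.1 k1).2
    have k3 : 0 ≤ κ / 2 * ‖x - P x‖ ^ 2 := by positivity
    rw [hv.eq x]
    linarith
  set S : Set E := closure Ω ∩ h ⁻¹' Set.Ici (M + 3 * τ) with hSdef
  have hSΩ : S ⊆ Ω := fun x hx => hfr x hx.1 (by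
    have : M + 3 * τ ≤ h x := hx.2
    linarith)
  have hScomp : IsCompact S :=
    hK.of_isClosed_subset (hhc.preimage_isClosed_of_isClosed isClosed_closure isClosed_Ici)
      Set.inter_subset_left
  obtain ⟨ρ, hρ, hρΩ⟩ := hScomp.exists_thickening_subset_open hΩ hSΩ
  set r : ℝ := τ / (2 * R + 1) with hrdef
  have hr : 0 < r := by positivity
  have hmax : ∀ p ∈ ball (0 : E) r, ∃ x ∈ S, IsMaxOn (fun y => w y - v y - inner ℝ p y) Ω x := by
    intro p hp
    obtain ⟨x, hx, hxmax⟩ := hK.exists_isMaxOn ⟨x₀, hx₀⟩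
      (f := fun y => w y - v y - inner ℝ p y)
      ((hwc.sub hvc.continuousOn).sub (by fun_prop))
    refine ⟨x, ⟨hx, ?_⟩, hxmax.on_subset subset_closure⟩
    have k1 := hxmax hx₀
    simp only [Set.mem_ofPred_eq] at k1
    have k2 := hvle x₀ hx₀
    have k3 := hvge x hx
    have k4 : inner ℝ p x₀ - inner ℝ p x ≤ τ := by
      rw [← inner_sub_right]
      refine (real_inner_le_norm _ _).trans ?_
      have k5 := (norm_sub_le x₀ x).trans (add_le_add (hR _ hx₀) (hR _ hx))
      have k6 : ‖p‖ ≤ r := (mem_ball_zero_iff.1 hp).le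
      calc ‖p‖ * ‖x₀ - x‖ ≤ r * (2 * R + 1) := by
            gcongr
            linarith
        _ = τ := by
            rw [hrdef]
            field_simp
    show M + 3 * τ ≤ h x
    simp only [hh] at hhx₀ ⊢
    linarith
  have hlip : LipschitzWith (Real.toNNReal (2 * κ)) fun y => innerSL ℝ (κ • (y - P y)) := by
    refine LipschitzWith.of_dist_le_mul fun x y => ?_
    rw [Real.coe_toNNReal _ (by positivity), dist_eq_norm, dist_eq_norm, ← map_sub,
      innerSL_apply_norm]
    exact hv.norm_grad_sub_le hκ hu₂c x y
  obtain ⟨x, hxS, hxN, p, hp⟩ := exists_contact_notMem_null volume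
    (convexOn_add_sq_norm h₁.convexOn ha.le) hκ (fun x y => hv.le_add_quadratic x y)
    (fun x y => hv.norm_grad_sub_le hκ hu₂c x y) hρ
    (fun x hx => (ball_subset_thickening hx ρ).trans hρΩ) hr hmax
    (ae_iff.1 (hlip.ae_differentiableAt (μ := volume)))
  have hxΩ : x ∈ Ω := hSΩ hxS
  have hdist := hP x hxS.1
  have hPΩ : P x ∈ Ω := by
    refine hfr _ (hv.mem x) ?_
    have k1 := hhδ x hxS.1 _ (hv.mem x)
      (hdist.trans_le ((min_le_right _ _).trans (min_le_left _ _)))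
    rw [Real.dist_eq] at k1
    have k2 : M + 3 * τ ≤ h x := hxS.2
    linarith [(abs_lt.1 k1).2]
  have hfinal := add_pow_le_of_contact hd hΩ h₁.convexOn h₁.subsolution h₂.supersolution hu₂c hκ
    hv ha hxΩ hPΩ hp (by simpa using hxN)
  have k1 := hfδ x hxS.1 _ (hv.mem x)
    (hdist.trans_le ((min_le_right _ _).trans (min_le_right _ _)))
  rw [Real.dist_eq] at k1
  linarith [(abs_lt.1 k1).1, hf x hxΩ]

theorem abs_le_supNorm {S K : Set E} (hSK : S ⊆ K) (hK : IsCompact K) {w : E → ℝ}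
    (hw : ContinuousOn w K) {x : E} (hx : x ∈ S) : |w x| ≤ supNorm S w := by
  obtain ⟨b, hb⟩ := hK.exists_bound_of_continuousOn hw
  exact le_ciSup (f := fun x : S => |w x|)
    ⟨b, Set.forall_mem_range.2 fun y => hb y (hSK y.2)⟩ ⟨x, hx⟩

theorem supNorm_nonneg (S : Set E) (w : E → ℝ) : 0 ≤ supNorm S w :=
  Real.iSup_nonneg fun _ => abs_nonneg _

theorem sub_le_rpow (hd : 1 ≤ d) {Ω : Set E} (hΩ : IsOpen Ω) {R : ℝ}
    (hR : ∀ y ∈ closure Ω, ‖y‖ ≤ R) {f₁ f₂ g₁ g₂ u₁ u₂ : E → ℝ}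
    (hf₂ : ContinuousOn f₂ (closure Ω)) (h₁ : IsConvexViscositySolution Ω f₁ g₁ u₁)
    (h₂ : IsConvexViscositySolution Ω f₂ g₂ u₂) {ε m : ℝ} (hε : 0 ≤ ε)
    (hf : ∀ x ∈ Ω, f₂ x ≤ f₁ x + ε) (hm : ∀ x ∈ frontier Ω, g₁ x - g₂ x ≤ m) {x : E}
    (hx : x ∈ closure Ω) : u₁ x - u₂ x ≤ R ^ 2 / 2 * ε ^ ((1 : ℝ) / d) + m := by
  set s : ℝ := ε ^ ((1 : ℝ) / d) with hs
  have hs0 : 0 ≤ s := Real.rpow_nonneg hε _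
  have hsd : s ^ d = ε := by
    rw [hs, one_div, Real.rpow_inv_natCast_pow hε (by omega)]
  -- The contradiction needs `ε < a ^ d` strictly, so `a = s` is reached only in the limit.
  have t : Tendsto (fun a : ℝ => m + a / 2 * R ^ 2) (𝓝[>] s) (𝓝 (m + s / 2 * R ^ 2)) := by
    have : Continuous fun a : ℝ => m + a / 2 * R ^ 2 := by fun_prop
    exact (this.tendsto s).mono_left nhdsWithin_le_nhds
  have key : u₁ x - u₂ x ≤ m + s / 2 * R ^ 2 := by
    refine ge_of_tendsto t ?_
    filter_upwards [self_mem_nhdsWithin] with a ha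
    have ha : s < a := ha
    refine sub_le_of_lt_pow hd hΩ hR hf₂ h₁ h₂ (hs0.trans_lt ha) ?_ hf hm hx
    rw [← hsd]
    exact pow_lt_pow_left₀ ha hs0 (by omega)
  linarith

end Comparison

end MongeAmpere

theorem lemma5p3 {d : ℕ} (hd : 1 ≤ d) (Ω : Set (EuclideanSpace ℝ (Fin d)))
    (hΩ_open : IsOpen Ω) (hΩ_bdd : Bornology.IsBounded Ω) (hΩ_conv : Convex ℝ Ω) :
    ∃ C : ℝ, 0 < C ∧
      ∀ f₁ f₂ g₁ g₂ u₁ u₂ : EuclideanSpace ℝ (Fin d) → ℝ,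
        ContinuousOn f₁ (closure Ω) → ContinuousOn f₂ (closure Ω) →
        (∀ x ∈ closure Ω, 0 ≤ f₁ x) → (∀ x ∈ closure Ω, 0 ≤ f₂ x) →
        ContinuousOn g₁ (frontier Ω) → ContinuousOn g₂ (frontier Ω) →
        MongeAmpere.IsConvexViscositySolution Ω f₁ g₁ u₁ →
        MongeAmpere.IsConvexViscositySolution Ω f₂ g₂ u₂ →
        MongeAmpere.supNorm Ω (fun x => u₁ x - u₂ x) ≤
          C * MongeAmpere.supNorm Ω (fun x => f₁ x - f₂ x) ^ ((1 : ℝ) / d) +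
            MongeAmpere.supNorm (frontier Ω) (fun x => g₁ x - g₂ x) := by
  obtain ⟨R, hR⟩ := isBounded_iff_forall_norm_le.1 hΩ_bdd.closure
  -- The `+ 1` only ensures positivity, as `R = 0` is possible for empty `Ω`.
  refine ⟨R ^ 2 / 2 + 1, by positivity, ?_⟩
  intro f₁ f₂ g₁ g₂ u₁ u₂ hf₁ hf₂ _ _ hg₁ hg₂ h₁ h₂
  have hK : IsCompact (closure Ω) := hΩ_bdd.isCompact_closure
  have hKf : IsCompact (frontier Ω) :=
    hK.of_isClosed_subset isClosed_frontier frontier_subset_closure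
  set ε := MongeAmpere.supNorm Ω (fun x => f₁ x - f₂ x) with hε
  set m := MongeAmpere.supNorm (frontier Ω) (fun x => g₁ x - g₂ x) with hm
  have hε0 : 0 ≤ ε := MongeAmpere.supNorm_nonneg _ _
  have hm0 : 0 ≤ m := MongeAmpere.supNorm_nonneg _ _
  have hs0 : 0 ≤ ε ^ ((1 : ℝ) / d) := Real.rpow_nonneg hε0 _
  have hf : ∀ x ∈ Ω, |f₁ x - f₂ x| ≤ ε := fun x hx =>
    MongeAmpere.abs_le_supNorm subset_closure hK (hf₁.sub hf₂) hx
  have hg : ∀ x ∈ frontier Ω, |g₁ x - g₂ x| ≤ m := fun x hx =>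
    MongeAmpere.abs_le_supNorm subset_rfl hKf (hg₁.sub hg₂) hx
  refine Real.iSup_le (fun x => ?_) (by positivity)
  have hx : (x : EuclideanSpace ℝ (Fin d)) ∈ closure Ω := subset_closure x.2
  have k1 := MongeAmpere.sub_le_rpow hd hΩ_open hR hf₂ h₁ h₂ hε0
    (fun y hy => by linarith [(abs_le.1 (hf y hy)).1])
    (fun y hy => (abs_le.1 (hg y hy)).2) hx
  have k2 := MongeAmpere.sub_le_rpow hd hΩ_open hR hf₁ h₂ h₁ (m := m) hε0
    (fun y hy => by linarith [(abs_le.1 (hf y hy)).2])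
    (fun y hy => by linarith [(abs_le.1 (hg y hy)).1]) hx
  rw [abs_le]
  constructor <;> linarith
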